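/- Let $M$ be a finite-dimensional smooth manifold, $\pi:TM\setminus 0\to M$ its slit tangent bundle, $\mathscr{V}TM=\ker d\pi$ the vertical bundle over $TM\setminus 0$, $i_w:T_{\pi(w)}M\to\mathscr{V}_wTM$, $i_w(u)=\frac{d}{dt}\big|_{t=0}(w+tu)$, the vertical lift, $C(w)=i_w(w)$ the canonical vector field and $\mathscr{J}(X)=i_w(d\pi(X))$ $(X\in T_w(TM\setminus 0))$ the almost-tangent structure. Let $S$ be a spray on $M$, i.e. a smooth vector field on $TM\setminus 0$ with $\mathscr{J}(S)=C$ and $[C,S]=S$, let $\Gamma_S=-[S,\mathscr{J}]$ (minus the Lie derivative of $\mathscr J$ along $S$) be its canonical connection and $\mathscr{H}TM=\ker(\Gamma_S-\mathbf{I})$ its horizontal distribution. Let $\nabla$ be a smooth linear connection on the vector bundle $\mathscr{V}TM\to TM\setminus 0$ which is a lift of $\Gamma_S$, i.e. $\nabla_XC=X$ for every vertical $X$, and the kernel of $X\mapsto\nabla_XC$ is $\mathscr{H}TM$. For $w\in TM\setminus 0$, $u\in T_{\pi(w)}M$ and a smooth vector field $V$ defined near $\pi(w)$, put $D^w_uV=i_w^{-1}\nabla_{u^{\mathfrak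 h}}V^{\mathfrak v}$, where $u^{\mathfrak h}\in\mathscr{H}_wTM$ is the horizontal lift of $u$ at $w$ and $V^{\mathfrak v}(v)=i_v(V(\pi(v)))$ is the vertical lift of $V$. For a smooth curve $\lambda:I\to M$ and a nowhere vanishing vector field $W$ along $\lambda$, let $\frac{D^W}{dt}$ be the covariant derivative of vector fields along $\lambda$ whose value at time $t$ is induced by $D^{W(t)}$: if $(e_i)$ is a coordinate frame near $\lambda(t)$ and $V=\sum_i V^ie_i$ along $\lambda$, then $\frac{D^WV}{dt}(t)=\sum_i\big(\dot V^i(t)\,e_i+V^i(t)\,D^{W(t)}_{\dot\lambda(t)}e_i\big)$. Let $I\subseteq\mathbb{R}$ be a non-degenerate interval and $\lambda:I\to M$ a regular curve (smooth with $\dot\lambda(t)\ne 0$ for all $t\in I$). Then $\lambda$ is a geodesic of $S$ (i.e. $t\mapsto\dot\lambda(t)$ is an integral curve of $S$) if and only if $\frac{D^{\dot\lambda}\dot\lambda}{dt}=0$ for all $t\in I$. -/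

import Mathlib

open Bundle
open scoped Manifold ContDiff

noncomputable section

namespace SprayGeometry

variable {E : Type*} [NormedAddCommGroup E] [NormedSpace ℝ E]
  {M : Type*} [TopologicalSpace M] [ChartedSpace E M] [IsManifold 𝓘(ℝ, E) ∞ M]

/-! ### The slit tangent bundle and its vertical bundle

`M` is a smooth manifold without boundary modelled on `E`. The slit tangent bundle `TM \ 0` is an
open subset of the manifold `TM`, so its tangent space at `w` is `T_w TM`. Objects living on
`TM \ 0` are represented by functions on `TM` whose values on the zero section are irrelevant. -/

/-- The slit tangent bundle `TM \ 0`, as a subset of `TM`. -/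
def slit : Set (TangentBundle 𝓘(ℝ, E) M) := {w | w.2 ≠ 0}

/-- The differential `dπ(w) : T_w TM → T_{π(w)} M` of the projection. -/
def dproj (w : TangentBundle 𝓘(ℝ, E) M) :
    TangentSpace 𝓘(ℝ, E).tangent w →L[ℝ] TangentSpace 𝓘(ℝ, E) w.proj :=
  mfderiv 𝓘(ℝ, E).tangent 𝓘(ℝ, E)
    (TotalSpace.proj (F := E) (E := TangentSpace 𝓘(ℝ, E) (M := M))) w

/-- The vertical space `V_w TM = ker dπ(w)`. -/
def vertical (w : TangentBundle 𝓘(ℝ, E) M) : Submodule ℝ (TangentSpace 𝓘(ℝ, E).tangent w) :=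
  LinearMap.ker (dproj w).toLinearMap

/-- The curve `t ↦ w + t • u` in the fibre through `w`. -/
def fiberLine (w : TangentBundle 𝓘(ℝ, E) M) (u : TangentSpace 𝓘(ℝ, E) w.proj) (t : ℝ) :
    TangentBundle 𝓘(ℝ, E) M := ⟨w.proj, w.2 + t • u⟩

/-- The velocity `(d/dt)|_{t=0} (w + t • u)`. -/
def fiberVelocity (w : TangentBundle 𝓘(ℝ, E) M) (u : TangentSpace 𝓘(ℝ, E) w.proj) :
    TangentSpace 𝓘(ℝ, E).tangent w := mfderiv 𝓘(ℝ, ℝ) 𝓘(ℝ, E).tangent (fiberLine w u) 0 (1 : ℝ)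

lemma dproj_apply (w : TangentBundle 𝓘(ℝ, E) M) (ξ : TangentSpace 𝓘(ℝ, E).tangent w) :
    dproj w ξ = (ξ : E × E).1 := by
  have h : HasMFDerivAt 𝓘(ℝ, E).tangent 𝓘(ℝ, E)
      (TotalSpace.proj (F := E) (E := TangentSpace 𝓘(ℝ, E) (M := M))) w
      (ContinuousLinearMap.fst ℝ E E) := by
    refine ⟨(FiberBundle.continuous_proj E _).continuousAt, ?_⟩
    have hmem : (extChartAt 𝓘(ℝ, E).tangent w).target ∈
        nhds (extChartAt 𝓘(ℝ, E).tangent w w) := extChartAt_target_mem_nhds w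
    refine HasFDerivAt.hasFDerivWithinAt ?_
    refine HasFDerivAt.congr_of_eventuallyEq (f := Prod.fst) hasFDerivAt_fst ?_
    filter_upwards [hmem] with p hp
    rw [FiberBundle.extChartAt_target] at hp
    have h2 : ((extChartAt 𝓘(ℝ, E).tangent w).symm p).proj =
        (extChartAt 𝓘(ℝ, E) w.proj).symm p.1 := rfl
    simp only [writtenInExtChartAt, Function.comp_apply, h2]
    exact (extChartAt 𝓘(ℝ, E) w.proj).right_inv hp.1.1
  exact congrArg (fun L => L ξ) h.mfderiv

lemma fiberLine_coord (w : TangentBundle 𝓘(ℝ, E) M) (u : TangentSpace 𝓘(ℝ, E) w.proj) (t : ℝ) :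
    extChartAt 𝓘(ℝ, E).tangent w (fiberLine w u t) =
      (extChartAt 𝓘(ℝ, E) w.proj w.proj, (w.2 + t • u : TangentSpace 𝓘(ℝ, E) w.proj)) :=
  Prod.ext rfl ((tangentBundleCore 𝓘(ℝ, E) M).coordChange_self (achart E w.proj) w.proj
    (mem_chart_source E w.proj) _)

lemma hasDerivAt_line (c a b : E) :
    HasDerivAt (fun t : ℝ => (c, a + t • b)) ((0, b) : E × E) 0 := by
  have := ((hasDerivAt_id (0 : ℝ)).smul_const b).const_add a
  simpa using (hasDerivAt_const (0 : ℝ) c).prodMk this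

lemma fiberVelocity_eq (w : TangentBundle 𝓘(ℝ, E) M) (u : TangentSpace 𝓘(ℝ, E) w.proj) :
    fiberVelocity w u = ((0, u) : E × E) := by
  have h0 : fiberLine w u 0 = w := by simp [fiberLine]
  have hc : ContinuousAt (fiberLine w u) 0 := by
    have : ContinuousAt (fun t : ℝ => (w.2 + t • u : TangentSpace 𝓘(ℝ, E) w.proj)) 0 := by
      fun_prop
    exact (FiberBundle.continuous_totalSpaceMk E (TangentSpace 𝓘(ℝ, E)) w.proj).continuousAt.comp
      this
  have h : HasMFDerivAt 𝓘(ℝ, ℝ) 𝓘(ℝ, E).tangent (fiberLine w u) 0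
      (ContinuousLinearMap.toSpanSingleton ℝ ((0, u) : E × E)) := by
    refine ⟨hc, HasFDerivAt.hasFDerivWithinAt ?_⟩
    have hw : writtenInExtChartAt 𝓘(ℝ, ℝ) 𝓘(ℝ, E).tangent 0 (fiberLine w u) =
        extChartAt 𝓘(ℝ, E).tangent w ∘ fiberLine w u := by
      simp only [writtenInExtChartAt, h0]
      rfl
    rw [hw, show extChartAt 𝓘(ℝ, E).tangent w ∘ fiberLine w u = _ from
      funext (fiberLine_coord w u)]
    exact (hasDerivAt_line (extChartAt 𝓘(ℝ, E) w.proj w.proj) w.2 u).hasFDerivAt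
  have := congrArg (fun L => L (1 : ℝ)) h.mfderiv
  exact this.trans (one_smul ℝ ((0, u) : E × E))

lemma mem_vertical_iff (w : TangentBundle 𝓘(ℝ, E) M) (ξ : TangentSpace 𝓘(ℝ, E).tangent w) :
    ξ ∈ vertical w ↔ (ξ : E × E).1 = 0 := by
  rw [← dproj_apply]; rfl

/-- The vertical lift `i_w : T_{π(w)} M → V_w TM`, `i_w(u) = (d/dt)|_{t=0} (w + t • u)`, together
with its inverse. -/
def verticalLift (w : TangentBundle 𝓘(ℝ, E) M) :
    TangentSpace 𝓘(ℝ, E) w.proj ≃ₗ[ℝ] vertical w where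
  toFun u := ⟨fiberVelocity w u, by rw [mem_vertical_iff, fiberVelocity_eq]⟩
  invFun ξ := ((ξ.1 : E × E).2 : E)
  map_add' u v := Subtype.ext <| by
    show fiberVelocity w (u + v) = fiberVelocity w u + fiberVelocity w v
    rw [fiberVelocity_eq, fiberVelocity_eq, fiberVelocity_eq]
    exact Prod.ext (add_zero (0 : E)).symm rfl
  map_smul' c u := Subtype.ext <| by
    show fiberVelocity w (c • u) = c • fiberVelocity w u
    rw [fiberVelocity_eq, fiberVelocity_eq]
    exact Prod.ext (smul_zero c).symm rfl
  left_inv u := by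
    show (fiberVelocity w u : E × E).2 = u
    rw [fiberVelocity_eq]
  right_inv ξ := Subtype.ext <|
    (fiberVelocity_eq w _).trans (Prod.ext ((mem_vertical_iff w ξ.1).1 ξ.2).symm rfl)

/-- The canonical vector field `C(w) = i_w(w)`, as a section of the vertical bundle. -/
def canonicalField (w : TangentBundle 𝓘(ℝ, E) M) : vertical w := verticalLift w w.2

/-- The almost-tangent structure `J(ξ) = i_w(dπ(ξ))`, `ξ ∈ T_w TM`. -/
def almostTangent (w : TangentBundle 𝓘(ℝ, E) M) :
    TangentSpace 𝓘(ℝ, E).tangent w →ₗ[ℝ] vertical w :=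
  (verticalLift w).toLinearMap ∘ₗ (dproj w).toLinearMap

/-- The vector field `X` is smooth at the point `w` of `TM`. -/
def SmoothAt (X : Π w : TangentBundle 𝓘(ℝ, E) M, TangentSpace 𝓘(ℝ, E).tangent w)
    (w : TangentBundle 𝓘(ℝ, E) M) : Prop :=
  ContMDiffAt 𝓘(ℝ, E).tangent 𝓘(ℝ, E).tangent.tangent ∞
    (fun v => (⟨v, X v⟩ : TangentBundle 𝓘(ℝ, E).tangent (TangentBundle 𝓘(ℝ, E) M))) w

/-! ### Sprays and the canonical connection -/

/-- `S` is a spray: a smooth vector field on `TM \ 0` with `J(S) = C` and `[C, S] = S`. -/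
structure IsSpray (S : Π w : TangentBundle 𝓘(ℝ, E) M, TangentSpace 𝓘(ℝ, E).tangent w) : Prop where
  smooth : ∀ w ∈ slit, SmoothAt S w
  secondOrder : ∀ w ∈ slit, almostTangent w (S w) = canonicalField w
  homogeneous : ∀ w ∈ slit,
    VectorField.mlieBracket 𝓘(ℝ, E).tangent (fun v => (canonicalField v).1) S w = S w

/-- `-[S, J]` applied to a vector field `X`, where `[S, J](X) = [S, J X] - J [S, X]` is the Lie
derivative of the tensor field `J` along `S`. -/
def grifoneField (S X : Π w : TangentBundle 𝓘(ℝ, E) M, TangentSpace 𝓘(ℝ, E).tangent w)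
    (w : TangentBundle 𝓘(ℝ, E) M) : TangentSpace 𝓘(ℝ, E).tangent w :=
  -(VectorField.mlieBracket 𝓘(ℝ, E).tangent S (fun v => (almostTangent v (X v)).1) w
    - (almostTangent w (VectorField.mlieBracket 𝓘(ℝ, E).tangent S X w)).1)

/-- The canonical connection `Γ_S = -[S, J]` on a tangent vector `ξ ∈ T_w TM`. It is a tensor, so
it is computed with a vector field that is smooth near `w` and has the value `ξ` at `w`. -/
def grifone (S : Π w : TangentBundle 𝓘(ℝ, E) M, TangentSpace 𝓘(ℝ, E).tangent w)
    (w : TangentBundle 𝓘(ℝ, E) M) (ξ : TangentSpace 𝓘(ℝ, E).tangent w) :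
    TangentSpace 𝓘(ℝ, E).tangent w :=
  grifoneField S (FiberBundle.extend (E × E) ξ) w

/-- The horizontal vectors: `ξ ∈ H_w TM = ker (Γ_S - I)`. -/
def IsHorizontal (S : Π w : TangentBundle 𝓘(ℝ, E) M, TangentSpace 𝓘(ℝ, E).tangent w)
    (w : TangentBundle 𝓘(ℝ, E) M) (ξ : TangentSpace 𝓘(ℝ, E).tangent w) : Prop :=
  grifone S w ξ = ξ

/-- The horizontal lift of `u ∈ T_{π(w)} M` at `w`: the (unique, for `w ∈ TM \ 0`) horizontal
`ξ ∈ T_w TM` with `dπ(ξ) = u`. -/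
def horizontalLift (S : Π w : TangentBundle 𝓘(ℝ, E) M, TangentSpace 𝓘(ℝ, E).tangent w)
    (w : TangentBundle 𝓘(ℝ, E) M) (u : TangentSpace 𝓘(ℝ, E) w.proj) :
    TangentSpace 𝓘(ℝ, E).tangent w :=
  Classical.epsilon fun ξ => IsHorizontal S w ξ ∧ dproj w ξ = u

/-! ### Linear connections on the vertical bundle over `TM \ 0` -/

variable (E M) in
/-- A (smooth) linear connection on the vertical bundle `VTM → TM \ 0`. `toFun σ w ξ` is
`∇_ξ σ ∈ V_w TM`, for a section `σ` and `ξ ∈ T_w TM`; only sections `σ` that are smooth at `w ∈ TM \ 0`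
matter. -/
structure VerticalConnection where
  toFun : (Π w : TangentBundle 𝓘(ℝ, E) M, vertical w) →
    Π w : TangentBundle 𝓘(ℝ, E) M, TangentSpace 𝓘(ℝ, E).tangent w →ₗ[ℝ] vertical w
  add : ∀ (σ τ : Π w : TangentBundle 𝓘(ℝ, E) M, vertical w), ∀ w ∈ slit,
    SmoothAt (fun v => (σ v).1) w → SmoothAt (fun v => (τ v).1) w →
    toFun (fun v => σ v + τ v) w = toFun σ w + toFun τ w
  leibniz : ∀ (f : TangentBundle 𝓘(ℝ, E) M → ℝ) (σ : Π w : TangentBundle 𝓘(ℝ, E) M, vertical w),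
    ∀ w ∈ slit, ContMDiffAt 𝓘(ℝ, E).tangent 𝓘(ℝ, ℝ) ∞ f w → SmoothAt (fun v => (σ v).1) w →
    ∀ ξ : TangentSpace 𝓘(ℝ, E).tangent w,
      toFun (fun v => f v • σ v) w ξ =
        f w • toFun σ w ξ + mvfderiv 𝓘(ℝ, E).tangent f w ξ • σ w
  smooth : ∀ (X : Π w : TangentBundle 𝓘(ℝ, E) M, TangentSpace 𝓘(ℝ, E).tangent w)
    (σ : Π w : TangentBundle 𝓘(ℝ, E) M, vertical w),
    (∀ w ∈ slit, SmoothAt X w) → (∀ w ∈ slit, SmoothAt (fun v => (σ v).1) w) →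
    ∀ w ∈ slit, SmoothAt (fun v => (toFun σ v (X v)).1) w

/-- `∇` is a lift of `Γ_S`: it is almost-projectable (`∇_ξ C = ξ` for `ξ` vertical), and the kernel
of `ξ ↦ ∇_ξ C` is the horizontal distribution of `Γ_S`. -/
structure IsLift (nabla : VerticalConnection E M)
    (S : Π w : TangentBundle 𝓘(ℝ, E) M, TangentSpace 𝓘(ℝ, E).tangent w) : Prop where
  almostProjectable : ∀ w ∈ slit, ∀ ξ : vertical w, nabla.toFun canonicalField w ξ.1 = ξ
  ker_eq : ∀ w ∈ slit, ∀ ξ : TangentSpace 𝓘(ℝ, E).tangent w,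
    nabla.toFun canonicalField w ξ = 0 ↔ IsHorizontal S w ξ

/-! ### The associated family of affine connections -/

/-- `D^w_u V = i_w⁻¹ (∇_{u^h} V^v)`, where `u^h` is the horizontal lift of `u` at `w`, and
`V^v(v) = i_v(V(π(v)))` is the vertical lift of the vector field `V`. -/
def affineConnection (nabla : VerticalConnection E M)
    (S : Π w : TangentBundle 𝓘(ℝ, E) M, TangentSpace 𝓘(ℝ, E).tangent w)
    (w : TangentBundle 𝓘(ℝ, E) M) (u : TangentSpace 𝓘(ℝ, E) w.proj)
    (V : Π x : M, TangentSpace 𝓘(ℝ, E) x) : TangentSpace 𝓘(ℝ, E) w.proj :=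
  (verticalLift w).symm
    (nabla.toFun (fun v => verticalLift v (V v.proj)) w (horizontalLift S w u))

/-- The velocity of the curve `c : s → M` at `t ∈ s`. -/
def velocity (c : ℝ → M) (s : Set ℝ) (t : ℝ) : TangentSpace 𝓘(ℝ, E) (c t) :=
  mfderivWithin 𝓘(ℝ, ℝ) 𝓘(ℝ, E) c s t (1 : ℝ)

/-- The covariant derivative `D^W V / dt` at time `t` of a vector field `V` along the curve
`c : s → M`, with reference vector field `W` along `c`. This is the derivation along `c` induced by
the map `D^w`, `w = W(t)`: if `e_i` is the coordinate frame of a chart at `c(t)` and `V = ∑ V^i e_i`,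
it is `∑ ((V^i)'(t) e_i + V^i(t) D^w_{c'(t)} e_i)`. -/
def covariantDerivAlong [FiniteDimensional ℝ E] (nabla : VerticalConnection E M)
    (S : Π w : TangentBundle 𝓘(ℝ, E) M, TangentSpace 𝓘(ℝ, E).tangent w)
    (c : ℝ → M) (s : Set ℝ) (W V : Π t : ℝ, TangentSpace 𝓘(ℝ, E) (c t)) (t : ℝ) :
    TangentSpace 𝓘(ℝ, E) (c t) :=
  let e := trivializationAt E (TangentSpace 𝓘(ℝ, E)) (c t)
  let b := Module.finBasis ℝ E
  ∑ i, (derivWithin (fun r => e.localFrameCoeff 𝓘(ℝ, E) b i (c r) (V r)) s t • e.localFrame b i (c t)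
    + e.localFrameCoeff 𝓘(ℝ, E) b i (c t) (V t) •
      affineConnection nabla S ⟨c t, W t⟩ (velocity c s t) (e.localFrame b i))

/-! ### Regular curves and geodesics -/

/-- The curve `c : s → M` is smooth, with nowhere vanishing velocity. -/
structure IsRegularCurve (c : ℝ → M) (s : Set ℝ) : Prop where
  smooth : ContMDiffOn 𝓘(ℝ, ℝ) 𝓘(ℝ, E) ∞ c s
  velocity_ne_zero : ∀ t ∈ s, velocity (E := E) c s t ≠ 0

/-- The curve `c : s → M` is a geodesic of `S`: its velocity curve `t ↦ (c(t), c'(t))` lies in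
`TM \ 0` and is an integral curve of `S`. -/
def IsGeodesic (S : Π w : TangentBundle 𝓘(ℝ, E) M, TangentSpace 𝓘(ℝ, E).tangent w)
    (c : ℝ → M) (s : Set ℝ) : Prop :=
  (∀ t ∈ s, (⟨c t, velocity c s t⟩ : TangentBundle 𝓘(ℝ, E) M) ∈ slit) ∧
    IsMIntegralCurveOn (fun t => (⟨c t, velocity c s t⟩ : TangentBundle 𝓘(ℝ, E) M)) S s

end SprayGeometry

end

noncomputable section

namespace SprayGeometry

open VectorField

variable {E : Type*} [NormedAddCommGroup E] [NormedSpace ℝ E]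
  {M : Type*} [TopologicalSpace M] [ChartedSpace E M] [IsManifold 𝓘(ℝ, E) ∞ M]

/-! ### Vertical vectors in induced charts -/

/-! Both sides of the equivalence say that the acceleration of `c`, a tangent vector to `TM` at `w =
ċ(t)`, equals `S w`.

The spray is horizontal: since `J S = C` and `[S, S] = 0`, the canonical connection gives `Γ_S(S) =
-[S, C] = [C, S] = S` (`IsSpray.isHorizontal`). Evaluating `Γ_S` on `S` itself, and not on an
arbitrary extension of `S w`, is legitimate because `Γ_S` is tensorial. Also `dπ(S w) = w`, and `∇C`
is the identity on vertical vectors, so a horizontal vector is determined by its projection. Hence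
the horizontal lift of `w` at `w` is `S w` (`horizontalLift_self`).

In an induced chart with fibre coordinates `y^i`, the canonical field is `C = ∑ y^i e_i^v`. By the
Leibniz rule, `∇_S C = 0` becomes `∑ y^i D^w_w e_i = -∑ S^i e_i`, where `S^i` are the fibre
components of `S w` (`sum_affineConnection_localFrame`). So the covariant derivative of the velocity
is `∑ (c̈^i - S^i) e_i`. It vanishes exactly when the fibre components of the acceleration and `S w`
agree. Their base components agree in any case, both vectors projecting to `ċ(t)`. -/

omit [IsManifold 𝓘(ℝ, E) ∞ M] in
lemma fiberLine_zero (w : TangentBundle 𝓘(ℝ, E) M) (u : TangentSpace 𝓘(ℝ, E) w.proj) :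
    fiberLine w u 0 = w := by simp [fiberLine]

lemma mdifferentiableAt_fiberLine (w : TangentBundle 𝓘(ℝ, E) M)
    (u : TangentSpace 𝓘(ℝ, E) w.proj) :
    MDifferentiableAt 𝓘(ℝ, ℝ) 𝓘(ℝ, E).tangent (fiberLine w u) 0 := by
  have hc : ContinuousAt (fiberLine w u) 0 := by
    have : ContinuousAt (fun t : ℝ => (w.2 + t • u : TangentSpace 𝓘(ℝ, E) w.proj)) 0 := by
      fun_prop
    exact (FiberBundle.continuous_totalSpaceMk E (TangentSpace 𝓘(ℝ, E)) w.proj).continuousAt.comp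
      this
  rw [mdifferentiableAt_iff]
  refine ⟨hc, DifferentiableAt.differentiableWithinAt ?_⟩
  have hw : writtenInExtChartAt 𝓘(ℝ, ℝ) 𝓘(ℝ, E).tangent 0 (fiberLine w u) =
      extChartAt 𝓘(ℝ, E).tangent w ∘ fiberLine w u := by
    simp only [writtenInExtChartAt, fiberLine_zero]
    rfl
  rw [hw, show extChartAt 𝓘(ℝ, E).tangent w ∘ fiberLine w u = _ from
    funext (fiberLine_coord w u)]
  exact (hasDerivAt_line (extChartAt 𝓘(ℝ, E) w.proj w.proj) w.2 u).differentiableAt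

lemma extChartAt_tangent_apply (w v : TangentBundle 𝓘(ℝ, E) M) :
    extChartAt 𝓘(ℝ, E).tangent w v =
      (extChartAt 𝓘(ℝ, E) w.proj v.proj,
        (trivializationAt E (TangentSpace 𝓘(ℝ, E)) w.proj v).2) := rfl

lemma mem_chart_source_tangent_iff (w v : TangentBundle 𝓘(ℝ, E) M) :
    v ∈ (chartAt (ModelProd E E) w).source ↔ v.proj ∈ (chartAt E w.proj).source := by
  exact TangentBundle.mem_chart_source_iff ..

lemma trivializationAt_snd {x₀ x : M} (hx : x ∈ (chartAt E x₀).source)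
    (u : TangentSpace 𝓘(ℝ, E) x) :
    (trivializationAt E (TangentSpace 𝓘(ℝ, E)) x₀).continuousLinearMapAt ℝ x u =
      (trivializationAt E (TangentSpace 𝓘(ℝ, E)) x₀ ⟨x, u⟩).2 := by
  rw [Trivialization.continuousLinearMapAt_apply,
    Trivialization.coe_linearMapAt_of_mem _ (by simpa using hx)]

/-- An induced chart is linear on each fibre, so it carries the line `v + t • u` to a line of
constant base point in `E × E`. -/
lemma mfderiv_extChartAt_fiberVelocity {w v : TangentBundle 𝓘(ℝ, E) M}
    (hv : v.proj ∈ (chartAt E w.proj).source) (u : TangentSpace 𝓘(ℝ, E) v.proj) :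
    (mfderiv 𝓘(ℝ, E).tangent 𝓘(ℝ, E × E) (extChartAt 𝓘(ℝ, E).tangent w) v
      (fiberVelocity v u) : E × E) =
      (0, (trivializationAt E (TangentSpace 𝓘(ℝ, E)) w.proj).continuousLinearMapAt ℝ v.proj u) := by
  have hd : MDifferentiableAt 𝓘(ℝ, E).tangent 𝓘(ℝ, E × E) (extChartAt 𝓘(ℝ, E).tangent w) v :=
    mdifferentiableAt_extChartAt ((mem_chart_source_tangent_iff w v).2 hv)
  have h := mfderiv_comp_apply_of_eq (x := (0 : ℝ)) hd (mdifferentiableAt_fiberLine v u)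
    (fiberLine_zero v u) (1 : ℝ)
  have hcoord : extChartAt 𝓘(ℝ, E).tangent w ∘ fiberLine v u = fun t : ℝ =>
      (extChartAt 𝓘(ℝ, E) w.proj v.proj,
        (trivializationAt E (TangentSpace 𝓘(ℝ, E)) w.proj).continuousLinearMapAt ℝ v.proj v.2 +
        t • (trivializationAt E (TangentSpace 𝓘(ℝ, E)) w.proj).continuousLinearMapAt ℝ v.proj u) := by
    funext t
    rw [← map_smul, ← map_add]
    refine Prod.ext rfl ?_
    exact (trivializationAt_snd hv (v.2 + t • u)).symm
  rw [hcoord, mfderiv_eq_fderiv, (hasDerivAt_line _ _ _).hasFDerivAt.fderiv] at h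
  exact h.symm.trans (one_smul ℝ (_ : E × E))

/-- The first component of an induced chart is the base chart composed with `π`; the chain rule is
applied to both descriptions. -/
lemma mfderiv_extChartAt_fst {w v : TangentBundle 𝓘(ℝ, E) M}
    (hv : v.proj ∈ (chartAt E w.proj).source) (ξ : TangentSpace 𝓘(ℝ, E).tangent v) :
    (mfderiv 𝓘(ℝ, E).tangent 𝓘(ℝ, E × E) (extChartAt 𝓘(ℝ, E).tangent w) v ξ : E × E).1 =
      (trivializationAt E (TangentSpace 𝓘(ℝ, E)) w.proj).continuousLinearMapAt ℝ v.proj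
        (dproj v ξ) := by
  have hd : MDifferentiableAt 𝓘(ℝ, E).tangent 𝓘(ℝ, E × E) (extChartAt 𝓘(ℝ, E).tangent w) v :=
    mdifferentiableAt_extChartAt ((mem_chart_source_tangent_iff w v).2 hv)
  have hd' : MDifferentiableAt 𝓘(ℝ, E) 𝓘(ℝ, E) (extChartAt 𝓘(ℝ, E) w.proj) v.proj :=
    mdifferentiableAt_extChartAt hv
  have hp : MDifferentiableAt 𝓘(ℝ, E).tangent 𝓘(ℝ, E)
      (TotalSpace.proj (F := E) (E := TangentSpace 𝓘(ℝ, E) (M := M))) v :=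
    (Bundle.contMDiffAt_proj (n := 1) _).mdifferentiableAt one_ne_zero
  have h1 := mfderiv_comp_apply v hd' hp ξ
  have h2 := mfderiv_comp_apply (I'' := 𝓘(ℝ, E)) (g := (Prod.fst : E × E → E)) v
    (differentiableAt_fst.mdifferentiableAt) hd ξ
  rw [TangentBundle.continuousLinearMapAt_trivializationAt hv]
  have h3 : mfderiv 𝓘(ℝ, E × E) 𝓘(ℝ, E) (Prod.fst : E × E → E)
      (extChartAt 𝓘(ℝ, E).tangent w v) = ContinuousLinearMap.fst ℝ E E := by
    rw [mfderiv_eq_fderiv, fderiv_fst]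
  rw [h3] at h2
  exact h2.symm.trans h1

lemma eventually_mem_chart_source (w : TangentBundle 𝓘(ℝ, E) M) :
    ∀ᶠ v in nhds w, v.proj ∈ (chartAt E w.proj).source :=
  (FiberBundle.continuous_proj E (TangentSpace 𝓘(ℝ, E))).continuousAt.eventually
    (chart_source_mem_nhds E w.proj)

/-- The components of a vector field on `TM` in the chart induced at `w`. -/
def inducedCoord (w : TangentBundle 𝓘(ℝ, E) M)
    (X : Π v : TangentBundle 𝓘(ℝ, E) M, TangentSpace 𝓘(ℝ, E).tangent v)
    (v : TangentBundle 𝓘(ℝ, E) M) : E × E :=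
  mfderiv 𝓘(ℝ, E).tangent 𝓘(ℝ, E × E) (extChartAt 𝓘(ℝ, E).tangent w) v (X v)

lemma inducedCoord_eventuallyEq (w : TangentBundle 𝓘(ℝ, E) M)
    (X : Π v : TangentBundle 𝓘(ℝ, E) M, TangentSpace 𝓘(ℝ, E).tangent v) :
    (fun v => (trivializationAt (E × E) (TangentSpace 𝓘(ℝ, E).tangent) w ⟨v, X v⟩).2) =ᶠ[nhds w]
      inducedCoord w X := by
  filter_upwards [eventually_mem_chart_source w] with v hv
  have hv' := (mem_chart_source_tangent_iff w v).2 hv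
  have h := TangentBundle.continuousLinearMapAt_trivializationAt (I := 𝓘(ℝ, E).tangent) hv'
  refine Eq.trans ?_ (congrArg (fun L => L (X v)) h)
  exact (congrFun (Trivialization.coe_linearMapAt_of_mem _ (by simpa using hv)) (X v)).symm

lemma smoothAt_iff {w : TangentBundle 𝓘(ℝ, E) M}
    {X : Π v : TangentBundle 𝓘(ℝ, E) M, TangentSpace 𝓘(ℝ, E).tangent v} :
    SmoothAt X w ↔ ContMDiffAt 𝓘(ℝ, E).tangent 𝓘(ℝ, E × E) ∞ (inducedCoord w X) w := by
  rw [SmoothAt, contMDiffAt_section]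
  exact (inducedCoord_eventuallyEq w X).contMDiffAt_iff

lemma mdifferentiableAt_vectorField_iff {w : TangentBundle 𝓘(ℝ, E) M}
    {X : Π v : TangentBundle 𝓘(ℝ, E) M, TangentSpace 𝓘(ℝ, E).tangent v} :
    MDifferentiableAt 𝓘(ℝ, E).tangent 𝓘(ℝ, E).tangent.tangent
      (fun v => (⟨v, X v⟩ : TangentBundle 𝓘(ℝ, E).tangent (TangentBundle 𝓘(ℝ, E) M))) w ↔
    MDifferentiableAt 𝓘(ℝ, E).tangent 𝓘(ℝ, E × E) (inducedCoord w X) w := by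
  rw [mdifferentiableAt_section]
  exact (inducedCoord_eventuallyEq w X).mdifferentiableAt_iff

lemma inducedCoord_verticalLift {w v : TangentBundle 𝓘(ℝ, E) M}
    (hv : v.proj ∈ (chartAt E w.proj).source)
    (U : Π v : TangentBundle 𝓘(ℝ, E) M, TangentSpace 𝓘(ℝ, E) v.proj) :
    inducedCoord w (fun v => (verticalLift v (U v)).1) v =
      (0, (trivializationAt E (TangentSpace 𝓘(ℝ, E)) w.proj ⟨v.proj, U v⟩).2) := by
  rw [← trivializationAt_snd hv]
  exact mfderiv_extChartAt_fiberVelocity hv (U v)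

/-- In an induced chart `J` is the constant map `(a, b) ↦ (0, a)`, so it preserves the regularity of
vector fields. -/
lemma inducedCoord_almostTangent {w v : TangentBundle 𝓘(ℝ, E) M}
    (hv : v.proj ∈ (chartAt E w.proj).source)
    (X : Π v : TangentBundle 𝓘(ℝ, E) M, TangentSpace 𝓘(ℝ, E).tangent v) :
    inducedCoord w (fun v => (almostTangent v (X v)).1) v = (0, (inducedCoord w X v).1) :=
  (mfderiv_extChartAt_fiberVelocity hv _).trans
    (Prod.ext rfl (mfderiv_extChartAt_fst hv (X v)).symm)

lemma mdifferentiableAt_almostTangent {w : TangentBundle 𝓘(ℝ, E) M}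
    {X : Π v : TangentBundle 𝓘(ℝ, E) M, TangentSpace 𝓘(ℝ, E).tangent v}
    (hX : MDifferentiableAt 𝓘(ℝ, E).tangent 𝓘(ℝ, E).tangent.tangent
      (fun v => (⟨v, X v⟩ : TangentBundle 𝓘(ℝ, E).tangent (TangentBundle 𝓘(ℝ, E) M))) w) :
    MDifferentiableAt 𝓘(ℝ, E).tangent 𝓘(ℝ, E).tangent.tangent
      (fun v => (⟨v, (almostTangent v (X v)).1⟩ :
        TangentBundle 𝓘(ℝ, E).tangent (TangentBundle 𝓘(ℝ, E) M))) w := by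
  rw [mdifferentiableAt_vectorField_iff] at hX ⊢
  have h : MDifferentiableAt 𝓘(ℝ, E).tangent 𝓘(ℝ, E × E)
      (fun v => ContinuousLinearMap.inr ℝ E E (ContinuousLinearMap.fst ℝ E E (inducedCoord w X v)))
      w := ((ContinuousLinearMap.inr ℝ E E ∘L ContinuousLinearMap.fst ℝ E E).differentiableAt
        |>.mdifferentiableAt).comp w hX
  refine h.congr_of_eventuallyEq ?_
  filter_upwards [eventually_mem_chart_source w] with v hv
  exact inducedCoord_almostTangent hv X

lemma smoothAt_verticalLift {w : TangentBundle 𝓘(ℝ, E) M}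
    {V : Π x : M, TangentSpace 𝓘(ℝ, E) x}
    (hV : ContMDiffAt 𝓘(ℝ, E) 𝓘(ℝ, E).tangent ∞
      (fun x => (⟨x, V x⟩ : TangentBundle 𝓘(ℝ, E) M)) w.proj) :
    SmoothAt (fun v => (verticalLift v (V v.proj)).1) w := by
  rw [smoothAt_iff]
  rw [contMDiffAt_section] at hV
  have h : ContMDiffAt 𝓘(ℝ, E).tangent 𝓘(ℝ, E × E) ∞ (fun v : TangentBundle 𝓘(ℝ, E) M =>
      ContinuousLinearMap.inr ℝ E E
        (trivializationAt E (TangentSpace 𝓘(ℝ, E)) w.proj ⟨v.proj, V v.proj⟩).2) w :=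
    ((ContinuousLinearMap.inr ℝ E E).contDiff.contMDiff.contMDiffAt).comp w
      (hV.comp w (Bundle.contMDiffAt_proj _))
  refine h.congr_of_eventuallyEq ?_
  filter_upwards [eventually_mem_chart_source w] with v hv
  exact inducedCoord_verticalLift hv (fun v => V v.proj)

/-- The fibre component of the chart is continuous and nonzero at `w`, and it sends zero vectors to
zero. -/
lemma eventually_mem_slit {w : TangentBundle 𝓘(ℝ, E) M} (hw : w ∈ slit) :
    ∀ᶠ v in nhds w, v ∈ slit := by
  have hcont : ContinuousAt (fun v => (extChartAt 𝓘(ℝ, E).tangent w v).2) w :=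
    (continuousAt_extChartAt w).snd
  have hne : (extChartAt 𝓘(ℝ, E).tangent w w).2 ≠ 0 := by
    have h := fiberLine_coord w 0 0
    rw [fiberLine_zero] at h
    rw [h]
    simpa [slit] using! hw
  filter_upwards [hcont.eventually_ne hne, eventually_mem_chart_source w] with v hv hv' h0
  apply hv
  rw [extChartAt_tangent_apply]
  show (trivializationAt E (TangentSpace 𝓘(ℝ, E)) w.proj ⟨v.proj, v.2⟩).2 = 0
  rw [← trivializationAt_snd hv', h0, map_zero]

/-! ### The spray is horizontal -/

variable [FiniteDimensional ℝ E]

/-- Replacing `X` by `f X` produces the term `(S f) J X` in both `[S, J X]` and `J [S, X]`; the two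
cancel. -/
lemma tensorialAt_grifoneField
    (S : Π w : TangentBundle 𝓘(ℝ, E) M, TangentSpace 𝓘(ℝ, E).tangent w)
    (w : TangentBundle 𝓘(ℝ, E) M) :
    TensorialAt 𝓘(ℝ, E).tangent (E × E) (fun X => grifoneField S X w) w where
  smul {f X} hf hX := by
    have : CompleteSpace (E × E) := FiniteDimensional.complete ℝ _
    have h1 := mlieBracket_smul_right (V := S) hf (mdifferentiableAt_almostTangent hX)
    have h2 := mlieBracket_smul_right (V := S) hf hX
    have h3 : (fun v => (almostTangent v ((f • X) v)).1) =
        f • (fun v => (almostTangent v (X v)).1) := by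
      funext v
      simp [map_smul]
    simp only [grifoneField]
    rw [h3, h1, h2]
    simp only [map_add, map_smul, Submodule.coe_add, Submodule.coe_smul]
    module
  add {X Y} hX hY := by
    have : CompleteSpace (E × E) := FiniteDimensional.complete ℝ _
    have h1 := mlieBracket_add_right (V := S) (mdifferentiableAt_almostTangent hX)
      (mdifferentiableAt_almostTangent hY)
    have h2 := mlieBracket_add_right (V := S) hX hY
    have h3 : (fun v => (almostTangent v ((X + Y) v)).1) =
        (fun v => (almostTangent v (X v)).1) + (fun v => (almostTangent v (Y v)).1) := by
      funext v
      simp [map_add]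
    simp only [grifoneField]
    rw [h3, h1, h2]
    simp only [map_add, Submodule.coe_add]
    module

/-- Tensoriality removes the dependence on the extension chosen in the definition of `grifone`. -/
lemma grifone_eq_grifoneField
    (S : Π w : TangentBundle 𝓘(ℝ, E) M, TangentSpace 𝓘(ℝ, E).tangent w)
    {X : Π w : TangentBundle 𝓘(ℝ, E) M, TangentSpace 𝓘(ℝ, E).tangent w}
    {w : TangentBundle 𝓘(ℝ, E) M} (hX : SmoothAt X w) :
    grifone S w (X w) = grifoneField S X w := by
  refine (tensorialAt_grifoneField S w).pointwise ?_ (hX.mdifferentiableAt (by simp)) ?_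
  · exact FiberBundle.mdifferentiableAt_extend _ _ _
  · exact FiberBundle.extend_apply_self (F := E × E) _

lemma IsSpray.isHorizontal
    {S : Π w : TangentBundle 𝓘(ℝ, E) M, TangentSpace 𝓘(ℝ, E).tangent w}
    (hS : IsSpray S) {w : TangentBundle 𝓘(ℝ, E) M} (hw : w ∈ slit) :
    IsHorizontal S w (S w) := by
  have hJ : (fun v => (almostTangent v (S v)).1) =ᶠ[nhds w] fun v => (canonicalField v).1 := by
    filter_upwards [eventually_mem_slit hw] with v hv
    rw [hS.secondOrder v hv]
  rw [IsHorizontal, grifone_eq_grifoneField S (hS.smooth w hw), grifoneField,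
    Filter.EventuallyEq.rfl.mlieBracket_vectorField_eq hJ, mlieBracket_self,
    mlieBracket_swap_apply, hS.homogeneous w hw]
  simp

/-! ### Locality and additivity of a connection -/

namespace VerticalConnection

variable (nabla : VerticalConnection E M)

omit [FiniteDimensional ℝ E] in
-- Locality is not an axiom of the connection; it follows from the Leibniz rule for a cutoff that is
-- only required to be smooth at `w`.
lemma toFun_congr {σ τ : Π w : TangentBundle 𝓘(ℝ, E) M, vertical w}
    {w : TangentBundle 𝓘(ℝ, E) M} (hw : w ∈ slit)
    (hσ : SmoothAt (fun v => (σ v).1) w) (hτ : SmoothAt (fun v => (τ v).1) w)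
    (h : ∀ᶠ v in nhds w, σ v = τ v) : nabla.toFun σ w = nabla.toFun τ w := by
  classical
  -- The indicator of the coincidence set: it is 1 near `w`, and `f σ = f τ` holds everywhere. The
  -- terms in `df` cancel because `σ w = τ w`.
  let f : TangentBundle 𝓘(ℝ, E) M → ℝ := fun v => if σ v = τ v then 1 else 0
  have hfw : f w = 1 := if_pos h.self_of_nhds
  have hf1 : f =ᶠ[nhds w] fun _ => 1 := h.mono fun v hv => if_pos hv
  have hf : ContMDiffAt 𝓘(ℝ, E).tangent 𝓘(ℝ, ℝ) ∞ f w :=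
    contMDiffAt_const.congr_of_eventuallyEq hf1
  have hfun : (fun v => f v • σ v) = fun v => f v • τ v := by
    funext v
    by_cases hv : σ v = τ v
    · rw [hv]
    · simp [f, hv]
  ext1 ξ
  have h1 := nabla.leibniz f σ w hw hf hσ ξ
  have h2 := nabla.leibniz f τ w hw hf hτ ξ
  rw [hfun, h2, hfw, h.self_of_nhds] at h1
  simpa using h1.symm

omit [FiniteDimensional ℝ E] in
lemma toFun_zero {w : TangentBundle 𝓘(ℝ, E) M} (hw : w ∈ slit) :
    nabla.toFun (fun _ => 0) w = 0 := by
  have h0 : SmoothAt (fun v => ((0 : vertical v) : TangentSpace 𝓘(ℝ, E).tangent v)) w :=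
    (Bundle.contMDiff_zeroSection ℝ (TangentSpace 𝓘(ℝ, E).tangent)).contMDiffAt
  have h := nabla.add _ _ w hw h0 h0
  simpa using h

omit [FiniteDimensional ℝ E] in
-- Smoothness is carried through the induction because additivity is only available for sections
-- smooth at `w`.
lemma toFun_sum {ι : Type*} (t : Finset ι)
    (σ : ι → Π w : TangentBundle 𝓘(ℝ, E) M, vertical w)
    {w : TangentBundle 𝓘(ℝ, E) M} (hw : w ∈ slit)
    (hσ : ∀ i, SmoothAt (fun v => (σ i v).1) w) :
    SmoothAt (fun v => (∑ i ∈ t, σ i v : vertical v).1) w ∧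
    nabla.toFun (fun v => ∑ i ∈ t, σ i v) w = ∑ i ∈ t, nabla.toFun (σ i) w := by
  classical
  induction t using Finset.induction_on with
  | empty =>
    refine ⟨?_, by simpa using nabla.toFun_zero hw⟩
    exact (Bundle.contMDiff_zeroSection ℝ (TangentSpace 𝓘(ℝ, E).tangent)).contMDiffAt
  | insert a t ha ih =>
    simp only [Finset.sum_insert ha]
    refine ⟨(hσ a).add_section ih.1, ?_⟩
    rw [nabla.add _ _ w hw (hσ a) ih.1, ih.2]

end VerticalConnection

/-! ### Fibre coordinates -/

variable {ι : Type*} [Fintype ι] (b : Module.Basis ι ℝ E)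

omit [FiniteDimensional ℝ E] [Fintype ι] in
lemma localFrameCoeff_eq_repr {x₀ x : M} (hx : x ∈ (chartAt E x₀).source) (i : ι)
    (u : TangentSpace 𝓘(ℝ, E) x) :
    (trivializationAt E (TangentSpace 𝓘(ℝ, E)) x₀).localFrameCoeff 𝓘(ℝ, E) b i x u =
      b.coord i (trivializationAt E (TangentSpace 𝓘(ℝ, E)) x₀ ⟨x, u⟩).2 := by
  have h := Trivialization.localFrameCoeff_eq_coeff (I := 𝓘(ℝ, E)) (b := b)
    (e := trivializationAt E (TangentSpace 𝓘(ℝ, E)) x₀) (s := FiberBundle.extend E u)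
    (x := x) (by simpa using hx) (i := i)
  simpa only [FiberBundle.extend_apply_self] using! h

/-- The `i`-th fibre coordinate of the chart induced at `w`. -/
def fibreCoord (w : TangentBundle 𝓘(ℝ, E) M) (i : ι) (v : TangentBundle 𝓘(ℝ, E) M) : ℝ :=
  (trivializationAt E (TangentSpace 𝓘(ℝ, E)) w.proj).localFrameCoeff 𝓘(ℝ, E) b i v.proj v.2

omit [Fintype ι] in
lemma fibreCoord_eventuallyEq (w : TangentBundle 𝓘(ℝ, E) M) (i : ι) :
    fibreCoord b w i =ᶠ[nhds w]
      ((b.coord i).toContinuousLinearMap ∘L ContinuousLinearMap.snd ℝ E E) ∘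
        extChartAt 𝓘(ℝ, E).tangent w := by
  filter_upwards [eventually_mem_chart_source w] with v hv
  exact localFrameCoeff_eq_repr b hv i v.2

omit [Fintype ι] in
lemma contMDiffAt_fibreCoord (w : TangentBundle 𝓘(ℝ, E) M) (i : ι) :
    ContMDiffAt 𝓘(ℝ, E).tangent 𝓘(ℝ, ℝ) ∞ (fibreCoord b w i) w := by
  refine ContMDiffAt.congr_of_eventuallyEq ?_ (fibreCoord_eventuallyEq b w i)
  exact (ContinuousLinearMap.contDiff _).contMDiff.contMDiffAt.comp w contMDiffAt_extChartAt

omit [Fintype ι] in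
-- The induced chart at `w` has identity derivative at `w` itself, so no transition map appears.
lemma mvfderiv_fibreCoord (w : TangentBundle 𝓘(ℝ, E) M) (i : ι)
    (ξ : TangentSpace 𝓘(ℝ, E).tangent w) :
    mvfderiv 𝓘(ℝ, E).tangent (fibreCoord b w i) w ξ = b.coord i (ξ : E × E).2 := by
  have h1 : mfderiv 𝓘(ℝ, E).tangent 𝓘(ℝ, ℝ) (fibreCoord b w i) w ξ =
      mfderiv 𝓘(ℝ, E).tangent 𝓘(ℝ, ℝ)
        (((b.coord i).toContinuousLinearMap ∘L ContinuousLinearMap.snd ℝ E E) ∘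
        extChartAt 𝓘(ℝ, E).tangent w) w ξ :=
    congrArg (fun L : E × E →L[ℝ] ℝ => L ξ) (fibreCoord_eventuallyEq b w i).mfderiv_eq
  have h2 := mfderiv_comp_apply (I'' := 𝓘(ℝ, ℝ)) w
    ((((b.coord i).toContinuousLinearMap ∘L ContinuousLinearMap.snd ℝ E E)).differentiableAt
      (x := extChartAt 𝓘(ℝ, E).tangent w w)).mdifferentiableAt
    (mdifferentiableAt_extChartAt (I := 𝓘(ℝ, E).tangent) (mem_chart_source _ w)) ξ
  rw [mfderiv_extChartAt_self, mfderiv_eq_fderiv, ContinuousLinearMap.fderiv] at h2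
  exact h1.trans h2

/-- The vertical lifts of the coordinate frame around `w`. -/
def verticalFrame (w : TangentBundle 𝓘(ℝ, E) M) (i : ι) (v : TangentBundle 𝓘(ℝ, E) M) :
    vertical v :=
  verticalLift v
    ((trivializationAt E (TangentSpace 𝓘(ℝ, E)) w.proj).localFrame b i v.proj)

omit [FiniteDimensional ℝ E] [Fintype ι] in
lemma smoothAt_verticalFrame (w : TangentBundle 𝓘(ℝ, E) M) (i : ι) :
    SmoothAt (fun v => (verticalFrame b w i v).1) w :=
  smoothAt_verticalLift (contMDiffAt_localFrame_of_mem ∞ _ b i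
    (FiberBundle.mem_baseSet_trivializationAt' w.proj))

omit [FiniteDimensional ℝ E] in
lemma canonicalField_eventually_eq (w : TangentBundle 𝓘(ℝ, E) M) :
    ∀ᶠ v in nhds w, ∑ i, fibreCoord b w i v • verticalFrame b w i v = canonicalField v := by
  filter_upwards [eventually_mem_chart_source w] with v hv
  have h := Trivialization.eq_sum_localFrameCoeff_smul (I := 𝓘(ℝ, E)) (b := b)
    (e := trivializationAt E (TangentSpace 𝓘(ℝ, E)) w.proj) (s := FiberBundle.extend E v.2)
    (x' := v.proj) (by simpa using hv)
  rw [FiberBundle.extend_apply_self] at h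
  rw [canonicalField]
  conv_rhs => rw [h]
  simp [map_sum, verticalFrame, fibreCoord]

/-- The Leibniz rule applied to `C = ∑ y^i e_i^v`; locality is needed since this expansion only
holds near `w`. -/
lemma VerticalConnection.toFun_canonicalField (nabla : VerticalConnection E M)
    {w : TangentBundle 𝓘(ℝ, E) M} (hw : w ∈ slit) (ξ : TangentSpace 𝓘(ℝ, E).tangent w) :
    nabla.toFun canonicalField w ξ =
      ∑ i, (fibreCoord b w i w • nabla.toFun (verticalFrame b w i) w ξ +
        b.coord i (ξ : E × E).2 • verticalFrame b w i w) := by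
  have hs : ∀ i, SmoothAt (fun v => (fibreCoord b w i v • verticalFrame b w i v).1) w := fun i =>
    (contMDiffAt_fibreCoord b w i).smul_section (smoothAt_verticalFrame b w i)
  obtain ⟨h1, h2⟩ := nabla.toFun_sum Finset.univ _ hw hs
  have hC : SmoothAt (fun v => (canonicalField v).1) w := by
    refine ContMDiffAt.congr_of_eventuallyEq h1 ?_
    filter_upwards [canonicalField_eventually_eq b w] with v hv
    rw [hv]
  rw [← nabla.toFun_congr hw h1 hC (canonicalField_eventually_eq b w), h2, LinearMap.sum_apply]
  refine Finset.sum_congr rfl fun i _ => ?_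
  rw [nabla.leibniz _ _ w hw (contMDiffAt_fibreCoord b w i) (smoothAt_verticalFrame b w i),
    mvfderiv_fibreCoord]

/-! ### The horizontal lift of the reference vector -/

omit [FiniteDimensional ℝ E] in
-- The difference is vertical, so `∇C` returns it unchanged, yet `∇C` kills both horizontal vectors.
lemma IsLift.eq_of_isHorizontal {nabla : VerticalConnection E M}
    {S : Π w : TangentBundle 𝓘(ℝ, E) M, TangentSpace 𝓘(ℝ, E).tangent w}
    (hnabla : IsLift nabla S) {w : TangentBundle 𝓘(ℝ, E) M} (hw : w ∈ slit)
    {ξ η : TangentSpace 𝓘(ℝ, E).tangent w} (hξ : IsHorizontal S w ξ) (hη : IsHorizontal S w η)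
    (h : dproj w ξ = dproj w η) : ξ = η := by
  have hv : ξ - η ∈ vertical w := by
    show dproj w (ξ - η) = 0
    rw [map_sub, h, sub_self]
  have h1 := hnabla.almostProjectable w hw ⟨ξ - η, hv⟩
  rw [map_sub, (hnabla.ker_eq w hw ξ).2 hξ, (hnabla.ker_eq w hw η).2 hη, sub_zero] at h1
  exact sub_eq_zero.1 (congrArg Subtype.val h1).symm

omit [FiniteDimensional ℝ E] in
lemma IsSpray.dproj_eq {S : Π w : TangentBundle 𝓘(ℝ, E) M, TangentSpace 𝓘(ℝ, E).tangent w}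
    (hS : IsSpray S) {w : TangentBundle 𝓘(ℝ, E) M} (hw : w ∈ slit) : dproj w (S w) = w.2 :=
  (verticalLift w).injective (hS.secondOrder w hw)

lemma horizontalLift_self {nabla : VerticalConnection E M}
    {S : Π w : TangentBundle 𝓘(ℝ, E) M, TangentSpace 𝓘(ℝ, E).tangent w}
    (hS : IsSpray S) (hnabla : IsLift nabla S) {w : TangentBundle 𝓘(ℝ, E) M} (hw : w ∈ slit) :
    horizontalLift S w w.2 = S w := by
  have h := Classical.epsilon_spec (p := fun ξ => IsHorizontal S w ξ ∧ dproj w ξ = w.2)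
    ⟨S w, hS.isHorizontal hw, hS.dproj_eq hw⟩
  exact hnabla.eq_of_isHorizontal hw h.1 (hS.isHorizontal hw) (h.2.trans (hS.dproj_eq hw).symm)

/-- This is `∇_S C = 0` in the coordinate frame: `S w` lies in the kernel of `∇C` and is the
horizontal lift of `w`. -/
lemma sum_affineConnection_localFrame {nabla : VerticalConnection E M}
    {S : Π w : TangentBundle 𝓘(ℝ, E) M, TangentSpace 𝓘(ℝ, E).tangent w}
    (hS : IsSpray S) (hnabla : IsLift nabla S) {w : TangentBundle 𝓘(ℝ, E) M} (hw : w ∈ slit) :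
    ∑ i, fibreCoord b w i w • affineConnection nabla S w w.2
        ((trivializationAt E (TangentSpace 𝓘(ℝ, E)) w.proj).localFrame b i) =
      -∑ i, b.coord i (S w : E × E).2 •
        (trivializationAt E (TangentSpace 𝓘(ℝ, E)) w.proj).localFrame b i w.proj := by
  have h := nabla.toFun_canonicalField b hw (S w)
  rw [(hnabla.ker_eq w hw (S w)).2 (hS.isHorizontal hw), Finset.sum_add_distrib] at h
  have h' := congrArg (verticalLift w).symm h.symm
  simp only [map_add, map_sum, map_smul, map_zero, verticalFrame,
    LinearEquiv.symm_apply_apply] at h'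
  rw [← eq_neg_iff_add_eq_zero] at h'
  rw [← h']
  simp only [affineConnection, horizontalLift_self hS hnabla hw]
  rfl

/-! ### The velocity curve in induced charts -/

omit [FiniteDimensional ℝ E] in
-- The velocity curve is the tangent map of `c` applied to the unit section of `Tℝ`.
lemma IsRegularCurve.mdifferentiableWithinAt_velocity {c : ℝ → M} {s : Set ℝ}
    (hc : IsRegularCurve (E := E) c s) (hs : UniqueDiffOn ℝ s) {t : ℝ} (ht : t ∈ s) :
    MDifferentiableWithinAt 𝓘(ℝ, ℝ) 𝓘(ℝ, E).tangent
      (fun r => (⟨c r, velocity c s r⟩ : TangentBundle 𝓘(ℝ, E) M)) s t := by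
  have h := hc.smooth.contMDiffOn_tangentMapWithin (m := ∞) le_rfl hs.uniqueMDiffOn
  have h1 : ContMDiff 𝓘(ℝ, ℝ) 𝓘(ℝ, ℝ).tangent ∞
      (fun r : ℝ => (⟨r, (1 : ℝ)⟩ : TangentBundle 𝓘(ℝ, ℝ) ℝ)) :=
    contMDiff_vectorSpace_iff_contDiff.2 contDiff_const
  have h2 := h.comp h1.contMDiffOn (s := s) (fun r hr => hr)
  exact (h2 t ht).mdifferentiableWithinAt (by simp)

/-- The acceleration `c''(t) ∈ T_{c'(t)} TM` of the curve `c : s → M`. -/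
def acceleration (c : ℝ → M) (s : Set ℝ) (t : ℝ) :
    TangentSpace 𝓘(ℝ, E).tangent (⟨c t, velocity c s t⟩ : TangentBundle 𝓘(ℝ, E) M) :=
  mfderivWithin 𝓘(ℝ, ℝ) 𝓘(ℝ, E).tangent
    (fun r => (⟨c r, velocity c s r⟩ : TangentBundle 𝓘(ℝ, E) M)) s t (1 : ℝ)

omit [FiniteDimensional ℝ E] in
-- The chain rule for `π ∘ ċ = c`.
lemma IsRegularCurve.dproj_acceleration {c : ℝ → M} {s : Set ℝ}
    (hc : IsRegularCurve (E := E) c s) (hs : UniqueDiffOn ℝ s) {t : ℝ} (ht : t ∈ s) :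
    dproj ⟨c t, velocity (E := E) c s t⟩ (acceleration c s t) = velocity c s t := by
  have hγ := hc.mdifferentiableWithinAt_velocity hs ht
  have hp : MDifferentiableAt 𝓘(ℝ, E).tangent 𝓘(ℝ, E)
      (TotalSpace.proj (F := E) (E := TangentSpace 𝓘(ℝ, E) (M := M)))
      (⟨c t, velocity c s t⟩ : TangentBundle 𝓘(ℝ, E) M) :=
    (Bundle.contMDiffAt_proj (n := 1) _).mdifferentiableAt one_ne_zero
  have h := mfderiv_comp_mfderivWithin t hp hγ (hs t ht).uniqueMDiffWithinAt
  exact (congrArg (fun L : ℝ →L[ℝ] E => L 1) h).symm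

omit [Fintype ι] in
lemma IsRegularCurve.derivWithin_fibreCoord {c : ℝ → M} {s : Set ℝ}
    (hc : IsRegularCurve (E := E) c s) (hs : UniqueDiffOn ℝ s) {t : ℝ} (ht : t ∈ s) (i : ι) :
    derivWithin (fun r => fibreCoord b ⟨c t, velocity c s t⟩ i ⟨c r, velocity c s r⟩) s t =
      b.coord i (acceleration c s t : E × E).2 := by
  have hγ := hc.mdifferentiableWithinAt_velocity hs ht
  have hy := (contMDiffAt_fibreCoord b (⟨c t, velocity c s t⟩ : TangentBundle 𝓘(ℝ, E) M)
    i).mdifferentiableAt (by simp)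
  have h := mfderiv_comp_mfderivWithin t hy hγ (hs t ht).uniqueMDiffWithinAt
  rw [mfderivWithin_eq_fderivWithin] at h
  exact (congrArg (fun L : ℝ →L[ℝ] ℝ => L 1) h).trans (mvfderiv_fibreCoord b _ i _)

omit [FiniteDimensional ℝ E] in
-- Turns the integral curve condition into an equation of vectors: the derivative exists, and a
-- linear map on `ℝ` is fixed by its value at 1.
lemma IsRegularCurve.hasMFDerivWithinAt_velocity_iff {c : ℝ → M} {s : Set ℝ}
    (hc : IsRegularCurve (E := E) c s) (hs : UniqueDiffOn ℝ s) {t : ℝ} (ht : t ∈ s)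
    (ξ : TangentSpace 𝓘(ℝ, E).tangent (⟨c t, velocity c s t⟩ : TangentBundle 𝓘(ℝ, E) M)) :
    HasMFDerivWithinAt 𝓘(ℝ, ℝ) 𝓘(ℝ, E).tangent
      (fun r => (⟨c r, velocity c s r⟩ : TangentBundle 𝓘(ℝ, E) M)) s t
      ((1 : ℝ →L[ℝ] ℝ).smulRight ξ) ↔ acceleration c s t = ξ := by
  constructor
  · intro h
    have h' := h.mfderivWithin (hs t ht).uniqueMDiffWithinAt
    exact (congrArg (fun L : ℝ →L[ℝ] E × E => L 1) h').trans (one_smul ℝ (ξ : E × E))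
  · rintro rfl
    have h := (hc.mdifferentiableWithinAt_velocity hs ht).hasMFDerivWithinAt
    have hL : ∀ L : ℝ →L[ℝ] E × E, (1 : ℝ →L[ℝ] ℝ).smulRight (L 1) = L := fun L =>
      ContinuousLinearMap.ext_ring (by simp)
    exact (hL _).symm ▸ h

lemma IsRegularCurve.covariantDerivAlong_velocity {nabla : VerticalConnection E M}
    {S : Π w : TangentBundle 𝓘(ℝ, E) M, TangentSpace 𝓘(ℝ, E).tangent w}
    (hS : IsSpray S) (hnabla : IsLift nabla S) {c : ℝ → M} {s : Set ℝ}
    (hc : IsRegularCurve (E := E) c s) (hs : UniqueDiffOn ℝ s) {t : ℝ} (ht : t ∈ s) :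
    covariantDerivAlong nabla S c s (velocity c s) (velocity c s) t =
      ∑ i, (Module.finBasis ℝ E).coord i
          ((acceleration c s t : E × E).2 - (S ⟨c t, velocity c s t⟩ : E × E).2) •
        (trivializationAt E (TangentSpace 𝓘(ℝ, E)) (c t)).localFrame (Module.finBasis ℝ E) i
          (c t) := by
  have hw : (⟨c t, velocity c s t⟩ : TangentBundle 𝓘(ℝ, E) M) ∈ slit := hc.velocity_ne_zero t ht
  have h := sum_affineConnection_localFrame (Module.finBasis ℝ E) hS hnabla hw
  have hd := fun i => hc.derivWithin_fibreCoord (Module.finBasis ℝ E) hs ht i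
  simp only [fibreCoord] at h hd
  simp only [covariantDerivAlong, Finset.sum_add_distrib, hd, map_sub, sub_smul,
    Finset.sum_sub_distrib]
  rw [h, sub_eq_add_neg]

lemma IsRegularCurve.covariantDerivAlong_velocity_eq_zero_iff {nabla : VerticalConnection E M}
    {S : Π w : TangentBundle 𝓘(ℝ, E) M, TangentSpace 𝓘(ℝ, E).tangent w}
    (hS : IsSpray S) (hnabla : IsLift nabla S) {c : ℝ → M} {s : Set ℝ}
    (hc : IsRegularCurve (E := E) c s) (hs : UniqueDiffOn ℝ s) {t : ℝ} (ht : t ∈ s) :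
    covariantDerivAlong nabla S c s (velocity c s) (velocity c s) t = 0 ↔
      acceleration c s t = S ⟨c t, velocity c s t⟩ := by
  have hw : (⟨c t, velocity c s t⟩ : TangentBundle 𝓘(ℝ, E) M) ∈ slit := hc.velocity_ne_zero t ht
  have hmem := FiberBundle.mem_baseSet_trivializationAt' (F := E)
    (E := TangentSpace 𝓘(ℝ, E) (M := M)) (c t)
  rw [hc.covariantDerivAlong_velocity hS hnabla hs ht]
  simp only [Trivialization.localFrame_apply_of_mem_baseSet _ _ hmem]
  constructor
  · intro h
    have h0 := Fintype.linearIndependent_iff.1 (Trivialization.basisAt _ _ hmem).linearIndependent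
      _ h
    have h2 := (Module.finBasis ℝ E).ext_elem (x := _ - _) (y := 0) fun i => (h0 i).trans
      (by simp)
    -- The frame coefficients only control the fibre component; the base components agree because
    -- both vectors project to the velocity.
    refine Prod.ext ?_ (sub_eq_zero.1 h2)
    have h1 := (hc.dproj_acceleration hs ht).trans (hS.dproj_eq hw).symm
    rwa [dproj_apply, dproj_apply] at h1
  · intro h
    simp [h]

end SprayGeometry

end

theorem mainTheorem11 {E : Type*} [NormedAddCommGroup E] [NormedSpace ℝ E] [FiniteDimensional ℝ E]
    {M : Type*} [TopologicalSpace M] [ChartedSpace E M] [IsManifold 𝓘(ℝ, E) ∞ M]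
    (S : Π w : TangentBundle 𝓘(ℝ, E) M, TangentSpace 𝓘(ℝ, E).tangent w)
    (hS : SprayGeometry.IsSpray S)
    (nabla : SprayGeometry.VerticalConnection E M) (hnabla : SprayGeometry.IsLift nabla S)
    (s : Set ℝ) (hs : s.OrdConnected) (hs' : s.Nontrivial)
    (c : ℝ → M) (hc : SprayGeometry.IsRegularCurve (E := E) c s) :
    SprayGeometry.IsGeodesic S c s ↔
      ∀ t ∈ s, SprayGeometry.covariantDerivAlong nabla S c s
        (SprayGeometry.velocity c s) (SprayGeometry.velocity c s) t = 0 := by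
  -- A nondegenerate interval has unique derivatives even at endpoints it contains, where they are
  -- one-sided.
  have hu : UniqueDiffOn ℝ s :=
    uniqueDiffOn_convex hs.convex (hs.convex.nontrivial_iff_nonempty_interior.1 hs')
  simp only [SprayGeometry.IsGeodesic, IsMIntegralCurveOn]
  refine ⟨fun h t ht => ?_, fun h => ⟨fun t ht => hc.velocity_ne_zero t ht, fun t ht => ?_⟩⟩
  · exact (hc.covariantDerivAlong_velocity_eq_zero_iff hS hnabla hu ht).2
      ((hc.hasMFDerivWithinAt_velocity_iff hu ht _).1 (h.2 t ht))
  · exact (hc.hasMFDerivWithinAt_velocity_iff hu ht _).2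
      ((hc.covariantDerivAlong_velocity_eq_zero_iff hS hnabla hu ht).1 (h t ht))
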